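/- Let $\mathcal D$ be the set of pairs $f=\{f^-,f^+\}$, where $f^+:\mathbb R\to\mathbb R$ is non-decreasing, right-continuous and satisfies $f^+(x+n)=f^+(x)+n$ for $n\in\mathbb Z$, and $f^-(x)=\lim_{y\uparrow x}f^+(y)$. The inverse of $f$ is $f^{-1}=\{(f^+)^{-1},(f^-)^{-1}\}\in\mathcal D$, with $(f^+)^{-1}(y)=\sup\{x:f^+(x)<y\}$ (its left-continuous member) and $(f^-)^{-1}(y)=\inf\{x:f^-(x)>y\}$ (its right-continuous member). Let $D^\circ(\mathbb R,\mathcal D)$ be the space of cadlag weak flows: families $\phi=(\phi_I)$ in $\mathcal D$, $I$ ranging over the bounded intervals, with $\phi_\emptyset=\mathrm{id}$, such that $\phi^-_{I_2}\circ\phi^-_{I_1}\le\phi^-_I\le\phi^+_I\le\phi^+_{I_2}\circ\phi^+_{I_1}$ whenever $I$ is the disjoint union of $I_1$ and $I_2$ with $I_1$ to the left of $I_2$, and such that for every $t$, $\phi_{(s,t)}\to\mathrm{id}$ as $s\uparrow t$ and $\phi_{(t,u)}\to\mathrm{id}$ as $u\downarrow t$, uniformly on $\mathbb R$. Both spaces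 carry the $\sigma$-algebra generated by the evaluations $f\mapsto f^+(x)$, respectively $\phi\mapsto\phi_I^+(x)$. The time-reversal of $\phi$ is $\hat\phi$, $\hat\phi_I=(\phi_{-I})^{-1}$. Let $\eta=\{\eta_{h,t}:h>0,t\in\mathbb R\}$ be a family of probability distributions on $\mathcal D$, measurable in $t$, and write $F_{h,t}$ for a random element with law $\eta_{h,t}$. A $D^\circ(\mathbb R,\mathcal D)$-valued random variable $\Phi$ is a (Poisson) disturbance flow with disturbance $F_h$ if there are on its probability space a Poisson random measure $N$ on $\mathbb R$ of intensity $h^{-1}$ and random elements $(F_n)_{n\in\mathbb Z}$ of $\mathcal D$ such that, with $N_t=N(0,t]$ for $t\ge0$, $N_t=-N(t,0]$ for $t<0$ and $t_n=\inf\{t:N_t\ge n\}$, conditionally on $N$ the $F_n$ are independent with $F_n\sim\eta_{h,t_n}$, and almost surely, for all $s\le t$, $$\Phi^\pm_{(s,t]}=F^\pm_{N_t}\circ\dots\circ F^\pm_{N_s+1}$$ (the identity if $N_s=N_t$), with $N_s$ (respectively $N_t$) replaced by the left limit $N_{s-}$ (respectively $N_{t-}$) for intervals that are closed on the left (respectively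 open on the right). A law on $D^\circ(\mathbb R,\mathcal D)$ is denoted $\mu_A^{F_h}$ if it is the law of such a $\Phi$; $\hat\mu$ denotes the image of $\mu$ under time-reversal. **Proposition.** Suppose that for all $h>0$ and $t,x\in\mathbb R$, $F^+_{h,t}(x)=F^-_{h,t}(x)$ almost surely. Set $G_{h,t}=(F_{h,-t})^{-1}$, i.e. $G_{h,t}$ has the law of $f^{-1}$ for $f\sim\eta_{h,-t}$. Then for every $h>0$ the time-reversal $\hat\Phi$ of any disturbance flow $\Phi$ with disturbance $F_h$ is a disturbance flow with disturbance $G_h$. Moreover, if $\mu=\mu_A^{F_h}$ is the law of a disturbance flow with disturbance $F_h$, then $\hat\mu$ is the law of a disturbance flow with disturbance $G_h$, and it is the only such law: $\hat\mu_A^{F_h}=\mu_A^{G_h}$. -/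

import Mathlib

open Set Filter Topology MeasureTheory ProbabilityTheory
open scoped ENNReal NNReal

/-- The space `𝒟` of pairs `f = {f⁻, f⁺}`, where `f⁺ : ℝ → ℝ` is non-decreasing, right-continuous
and of degree one, and `f⁻` is its left-continuous modification `f⁻ x = lim_{y ↑ x} f⁺ y`. -/
structure DegOnePair where
  /-- the left-continuous member `f⁻` of the pair -/
  minus : ℝ → ℝ
  /-- the right-continuous member `f⁺` of the pair -/
  plus : ℝ → ℝ
  monotone_plus : Monotone plus
  plus_add_int : ∀ (x : ℝ) (n : ℤ), plus (x + n) = plus x + n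
  rightCts_plus : ∀ x : ℝ, ContinuousWithinAt plus (Ici x) x
  tendsto_minus : ∀ x : ℝ, Tendsto plus (𝓝[<] x) (𝓝 (minus x))

namespace DegOnePair

/-- The identity of `ℝ` as an element of `𝒟`. -/
def ident : DegOnePair where
  minus := fun x => x
  plus := fun x => x
  monotone_plus := monotone_id
  plus_add_int := fun _ _ => rfl
  rightCts_plus := fun _ => continuousWithinAt_id
  tendsto_minus := fun x => (continuous_id.tendsto x).mono_left nhdsWithin_le_nhds

theorem minus_le_plus (f : DegOnePair) (x : ℝ) : f.minus x ≤ f.plus x := by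
  refine le_of_tendsto (f.tendsto_minus x) ?_
  filter_upwards [self_mem_nhdsWithin] with y hy
  exact f.monotone_plus (le_of_lt hy)

theorem plus_le_minus (f : DegOnePair) {x y : ℝ} (hxy : x < y) : f.plus x ≤ f.minus y := by
  refine ge_of_tendsto (f.tendsto_minus y) ?_
  filter_upwards [Ioo_mem_nhdsLT hxy] with z hz
  exact f.monotone_plus hz.1.le

theorem monotone_minus (f : DegOnePair) : Monotone f.minus := by
  intro x y hxy
  rcases hxy.eq_or_lt with rfl | h
  · exact le_rfl
  · exact (f.minus_le_plus x).trans (f.plus_le_minus h)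

theorem minus_add_int (f : DegOnePair) (x : ℝ) (n : ℤ) : f.minus (x + n) = f.minus x + n := by
  have h1 : Tendsto (fun y : ℝ => f.plus (y + n)) (𝓝[<] x) (𝓝 (f.minus (x + n))) := by
    refine (f.tendsto_minus (x + n)).comp ?_
    refine tendsto_nhdsWithin_iff.2 ⟨?_, ?_⟩
    · exact ((continuous_id.add continuous_const).tendsto x).mono_left nhdsWithin_le_nhds
    · filter_upwards [self_mem_nhdsWithin] with y hy
      have : y < x := hy
      simpa using this
  have h2 : Tendsto (fun y : ℝ => f.plus (y + n)) (𝓝[<] x) (𝓝 (f.minus x + n)) := by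
    simp_rw [f.plus_add_int]
    exact (f.tendsto_minus x).add_const _
  exact tendsto_nhds_unique h1 h2

theorem exists_plus_lt (f : DegOnePair) (y : ℝ) : ∃ x, f.plus x < y := by
  obtain ⟨n, hn⟩ := exists_int_lt (y - f.plus 0)
  refine ⟨0 + n, ?_⟩
  rw [f.plus_add_int]
  linarith

theorem exists_lt_minus (f : DegOnePair) (y : ℝ) : ∃ x, y < f.minus x := by
  obtain ⟨n, hn⟩ := exists_int_gt (y - f.minus 0)
  refine ⟨0 + n, ?_⟩
  rw [f.minus_add_int]
  linarith

/-- The left-continuous inverse of `f⁺`. -/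
noncomputable def invMinus (f : DegOnePair) (y : ℝ) : ℝ := sSup {x : ℝ | f.plus x < y}

/-- The right-continuous inverse of `f⁻`. -/
noncomputable def invPlus (f : DegOnePair) (y : ℝ) : ℝ := sInf {x : ℝ | y < f.minus x}

theorem plus_lt_iff (f : DegOnePair) (x y : ℝ) : f.plus x < y ↔ x < f.invMinus y := by
  have hbdd : BddAbove {x : ℝ | f.plus x < y} := by
    obtain ⟨z, hz⟩ := f.exists_lt_minus y
    refine ⟨z, fun w hw => ?_⟩
    by_contra hlt
    have h1 := f.monotone_plus (not_le.1 hlt).le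
    have h2 := f.minus_le_plus z
    have h3 : f.plus w < y := hw
    linarith
  constructor
  · intro h
    have hev : ∀ᶠ z in 𝓝[≥] x, f.plus z < y := (f.rightCts_plus x).eventually (gt_mem_nhds h)
    have hev' : ∀ᶠ z in 𝓝[>] x, f.plus z < y :=
      hev.filter_mono (nhdsWithin_mono x Ioi_subset_Ici_self)
    obtain ⟨z, hz, hxz⟩ := (hev'.and self_mem_nhdsWithin).exists
    exact lt_of_lt_of_le hxz (le_csSup hbdd hz)
  · intro h
    obtain ⟨z, hz, hxz⟩ := exists_lt_of_lt_csSup (f.exists_plus_lt y) h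
    exact lt_of_le_of_lt (f.monotone_plus hxz.le) hz

theorem lt_minus_iff (f : DegOnePair) (x y : ℝ) : y < f.minus x ↔ f.invPlus y < x := by
  have hbdd : BddBelow {x : ℝ | y < f.minus x} := by
    obtain ⟨z, hz⟩ := f.exists_plus_lt y
    refine ⟨z, fun w hw => ?_⟩
    by_contra hlt
    have h1 := f.plus_le_minus (not_le.1 hlt)
    have h2 := f.minus_le_plus w
    have h3 := f.monotone_plus (not_le.1 hlt).le
    have h4 : y < f.minus w := hw
    linarith
  constructor
  · intro h
    have hev : ∀ᶠ z in 𝓝[<] x, y < f.plus z := (f.tendsto_minus x).eventually (lt_mem_nhds h)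
    obtain ⟨z, hz, hzx⟩ := (hev.and self_mem_nhdsWithin).exists
    have hzx' : z < x := hzx
    obtain ⟨w, hzw, hwx⟩ := exists_between hzx'
    exact lt_of_le_of_lt (csInf_le hbdd (lt_of_lt_of_le hz (f.plus_le_minus hzw))) hwx
  · intro h
    obtain ⟨z, hz, hzx⟩ := exists_lt_of_csInf_lt (f.exists_lt_minus y) h
    exact lt_of_lt_of_le hz (f.monotone_minus hzx.le)

theorem monotone_invPlus (f : DegOnePair) : Monotone f.invPlus := by
  intro y y' hy
  by_contra hlt
  obtain ⟨x, hx, hx'⟩ := exists_between (not_le.1 hlt)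
  have h1 := (f.lt_minus_iff x y').2 hx
  have h2 := (f.lt_minus_iff x y).1 (lt_of_le_of_lt hy h1)
  linarith

/-- The inverse `f⁻¹ = {(f⁺)⁻¹, (f⁻)⁻¹}` of an element `f` of `𝒟`. -/
noncomputable def inv (f : DegOnePair) : DegOnePair where
  minus := f.invMinus
  plus := f.invPlus
  monotone_plus := f.monotone_invPlus
  plus_add_int := by
    intro y n
    have key : ∀ c : ℝ, f.invPlus (y + n) < c ↔ f.invPlus y + n < c := by
      intro c
      rw [← f.lt_minus_iff, ← lt_sub_iff_add_lt, ← lt_sub_iff_add_lt, ← f.lt_minus_iff]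
      have : f.minus (c - n) = f.minus c - n := by
        have := f.minus_add_int (c - n) n
        rw [sub_add_cancel] at this
        linarith
      rw [this]
    exact eq_of_forall_gt_iff key
  rightCts_plus := by
    intro y
    refine tendsto_order.2 ⟨fun c hc => ?_, fun c hc => ?_⟩
    · filter_upwards [self_mem_nhdsWithin] with z hz
      exact lt_of_lt_of_le hc (f.monotone_invPlus hz)
    · obtain ⟨x, hx, hxc⟩ := exists_between hc
      have h1 := (f.lt_minus_iff x y).2 hx
      filter_upwards [mem_nhdsWithin_of_mem_nhds (gt_mem_nhds h1)] with z hz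
      exact ((f.lt_minus_iff x z).1 hz).trans hxc
  tendsto_minus := by
    intro y
    refine tendsto_order.2 ⟨fun c hc => ?_, fun c hc => ?_⟩
    · obtain ⟨x, hcx, hx⟩ := exists_between hc
      have h1 := (f.plus_lt_iff x y).2 hx
      filter_upwards [Ioo_mem_nhdsLT h1] with z hz
      refine lt_of_lt_of_le hcx ?_
      by_contra hlt
      have h2 := (f.lt_minus_iff x z).2 (not_le.1 hlt)
      have h3 := f.minus_le_plus x
      linarith [hz.1]
    · obtain ⟨x, hx, hxc⟩ := exists_between hc
      obtain ⟨x', hxx', hxc'⟩ := exists_between hxc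
      have h1 : y ≤ f.plus x := by
        by_contra hlt
        exact absurd ((f.plus_lt_iff x y).1 (not_le.1 hlt)) (not_lt.2 hx.le)
      filter_upwards [self_mem_nhdsWithin] with z hz
      have hz' : z < y := hz
      have h2 := f.plus_le_minus hxx'
      exact ((f.lt_minus_iff x' z).1 (by linarith)).trans hxc'

/-- The σ-algebra on `𝒟` generated by the evaluations `f ↦ f⁺ x`; it is the Borel σ-algebra of the
usual metric on `𝒟`. -/
instance instMeasurableSpace : MeasurableSpace DegOnePair :=
  ⨆ x : ℝ, MeasurableSpace.comap (fun f : DegOnePair => f.plus x) inferInstance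

theorem measurable_plus (x : ℝ) : Measurable (fun f : DegOnePair => f.plus x) :=
  Measurable.of_comap_le (le_iSup (fun x : ℝ =>
    MeasurableSpace.comap (fun f : DegOnePair => f.plus x) inferInstance) x)

theorem measurable_of_plus {Ω : Type*} [MeasurableSpace Ω] {F : Ω → DegOnePair}
    (hF : ∀ x : ℝ, Measurable fun ω => (F ω).plus x) : Measurable F := by
  rw [measurable_iff_comap_le]
  simp only [instMeasurableSpace, MeasurableSpace.comap_iSup, MeasurableSpace.comap_comp]
  exact iSup_le fun x => (hF x).comap_le

theorem measurable_minus (x : ℝ) : Measurable (fun f : DegOnePair => f.minus x) := by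
  have hlim : ∀ f : DegOnePair,
      Tendsto (fun n : ℕ => f.plus (x - 1 / ((n : ℝ) + 1))) atTop (𝓝 (f.minus x)) := by
    intro f
    refine (f.tendsto_minus x).comp (tendsto_nhdsWithin_iff.2 ⟨?_, ?_⟩)
    · simpa using tendsto_const_nhds.sub (tendsto_one_div_add_atTop_nhds_zero_nat (𝕜 := ℝ))
    · refine Eventually.of_forall fun n => ?_
      have : (0 : ℝ) < 1 / ((n : ℝ) + 1) := by positivity
      simpa using this
  exact measurable_of_tendsto_metrizable (fun n => measurable_plus _) (tendsto_pi_nhds.2 hlim)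

theorem measurable_inv : Measurable inv := by
  refine measurable_of_plus fun y => measurable_of_Iio fun c => ?_
  have : (fun f : DegOnePair => f.inv.plus y) ⁻¹' Iio c = {f : DegOnePair | y < f.minus c} := by
    ext f
    exact (f.lt_minus_iff c y).symm
  rw [this]
  exact measurableSet_lt measurable_const (measurable_minus c)

theorem abs_inv_plus_sub_le (f : DegOnePair) {ε : ℝ} (hf : ∀ x, |f.minus x - x| ≤ ε) (y : ℝ) :
    |f.inv.plus y - y| ≤ ε := by
  have h1 : f.inv.plus y ≤ y + ε := by
    by_contra hlt
    obtain ⟨x, hx, hx'⟩ := exists_between (not_le.1 hlt)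
    have h2 : ¬ y < f.minus x := fun h => by
      have h3 : f.inv.plus y < x := (f.lt_minus_iff x y).1 h
      linarith
    have := (abs_le.1 (hf x)).1
    linarith
  have h2 : y - ε ≤ f.inv.plus y := by
    by_contra hlt
    obtain ⟨x, hx, hx'⟩ := exists_between (not_le.1 hlt)
    have h3 : y < f.minus x := (f.lt_minus_iff x y).2 hx
    have := (abs_le.1 (hf x)).2
    linarith
  exact abs_le.2 ⟨by linarith, by linarith⟩

theorem abs_inv_minus_sub_le (f : DegOnePair) {ε : ℝ} (hf : ∀ x, |f.plus x - x| ≤ ε) (y : ℝ) :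
    |f.inv.minus y - y| ≤ ε := by
  have h1 : f.inv.minus y ≤ y + ε := by
    by_contra hlt
    obtain ⟨x, hx, hx'⟩ := exists_between (not_le.1 hlt)
    have h3 : f.plus x < y := (f.plus_lt_iff x y).2 hx'
    have := (abs_le.1 (hf x)).1
    linarith
  have h2 : y - ε ≤ f.inv.minus y := by
    by_contra hlt
    obtain ⟨x, hx, hx'⟩ := exists_between (not_le.1 hlt)
    have h2 : ¬ f.plus x < y := fun h => by
      have h3 : x < f.inv.minus y := (f.plus_lt_iff x y).1 h
      linarith
    have := (abs_le.1 (hf x)).2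
    linarith
  exact abs_le.2 ⟨by linarith, by linarith⟩

end DegOnePair

/-- The bounded intervals of `ℝ` (of any type, possibly degenerate or empty). -/
def BddInterval : Type := {I : Set ℝ // I.OrdConnected ∧ Bornology.IsBounded I}

namespace BddInterval

/-- The interval `(s, t]`. -/
def ioc (s t : ℝ) : BddInterval := ⟨Ioc s t, ordConnected_Ioc, Metric.isBounded_Ioc s t⟩

/-- The interval `[s, t]`. -/
def icc (s t : ℝ) : BddInterval := ⟨Icc s t, ordConnected_Icc, Metric.isBounded_Icc s t⟩

/-- The interval `(s, t)`. -/
def ioo (s t : ℝ) : BddInterval := ⟨Ioo s t, ordConnected_Ioo, Metric.isBounded_Ioo s t⟩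

/-- The interval `[s, t)`. -/
def ico (s t : ℝ) : BddInterval := ⟨Ico s t, ordConnected_Ico, Metric.isBounded_Ico s t⟩

/-- The reflected interval `-I = {-x : x ∈ I}`. -/
def neg (I : BddInterval) : BddInterval :=
  ⟨{x : ℝ | -x ∈ I.1},
    ⟨fun _ hx _ hy _ hz => I.2.1.out hy hx ⟨neg_le_neg hz.2, neg_le_neg hz.1⟩⟩,
    by
      have h : {x : ℝ | -x ∈ I.1} = (fun x : ℝ => -x) '' I.1 := by
        ext x
        constructor
        · exact fun hx => ⟨-x, hx, neg_neg x⟩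
        · rintro ⟨z, hz, rfl⟩
          simpa using hz
      rw [h]
      exact (LipschitzWith.id.neg).isBounded_image I.2.2⟩

theorem neg_ioo (s t : ℝ) : (ioo s t).neg = ioo (-t) (-s) := by
  refine Subtype.ext (Set.ext fun x => ?_)
  simp only [neg, ioo, mem_ofPred_eq, mem_Ioo]
  constructor <;> rintro ⟨h1, h2⟩ <;> constructor <;> linarith

end BddInterval

/-- The space `D°(ℝ, 𝒟)` of cadlag weak flows `φ = (φ_I)`, with `I` ranging over the bounded
intervals of `ℝ` and `φ_∅ = id`. -/
structure CadlagWeakFlow where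
  /-- the map `φ_I` -/
  toFun : BddInterval → DegOnePair
  map_empty : ∀ I : BddInterval, I.1 = ∅ → toFun I = DegOnePair.ident
  minus_comp_le : ∀ I₁ I₂ I : BddInterval, (∀ x ∈ I₁.1, ∀ y ∈ I₂.1, x < y) →
    I.1 = I₁.1 ∪ I₂.1 → ∀ x, (toFun I₂).minus ((toFun I₁).minus x) ≤ (toFun I).minus x
  le_plus_comp : ∀ I₁ I₂ I : BddInterval, (∀ x ∈ I₁.1, ∀ y ∈ I₂.1, x < y) →
    I.1 = I₁.1 ∪ I₂.1 → ∀ x, (toFun I).plus x ≤ (toFun I₂).plus ((toFun I₁).plus x)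
  cadlag_left : ∀ t ε : ℝ, 0 < ε → ∀ᶠ s in 𝓝[<] t, ∀ x : ℝ,
    |(toFun (BddInterval.ioo s t)).minus x - x| ≤ ε ∧
    |(toFun (BddInterval.ioo s t)).plus x - x| ≤ ε
  cadlag_right : ∀ t ε : ℝ, 0 < ε → ∀ᶠ u in 𝓝[>] t, ∀ x : ℝ,
    |(toFun (BddInterval.ioo t u)).minus x - x| ≤ ε ∧
    |(toFun (BddInterval.ioo t u)).plus x - x| ≤ ε

namespace CadlagWeakFlow

/-- The time-reversal `φ̂` of a flow `φ`, given by `φ̂_I = (φ_{-I})⁻¹`. -/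
noncomputable def reversal (φ : CadlagWeakFlow) : CadlagWeakFlow where
  toFun := fun I => (φ.toFun I.neg).inv
  map_empty := by
    intro I hI
    have h : I.neg.1 = ∅ := by
      ext x
      simp [BddInterval.neg, hI]
    rw [φ.map_empty _ h]
    have h1 : DegOnePair.ident.invMinus = fun y => y := by
      funext y
      refine eq_of_forall_lt_iff fun c => ?_
      rw [← DegOnePair.plus_lt_iff]
      exact Iff.rfl
    have h2 : DegOnePair.ident.invPlus = fun y => y := by
      funext y
      refine eq_of_forall_gt_iff fun c => ?_
      rw [← DegOnePair.lt_minus_iff]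
      exact Iff.rfl
    simp only [DegOnePair.inv, h1, h2]
    rfl
  minus_comp_le := by
    intro I₁ I₂ I hlt hI y
    have h := φ.le_plus_comp I₂.neg I₁.neg I.neg
      (fun x hx z hz => by have := hlt _ hz _ hx; linarith)
      (by
        ext x
        simp only [BddInterval.neg, hI, mem_ofPred_eq, mem_union]
        exact or_comm)
    refine le_of_forall_lt fun c hc => ?_
    have h1 := (DegOnePair.plus_lt_iff _ _ _).2 hc
    have h2 := (DegOnePair.plus_lt_iff _ _ _).2 h1
    exact (DegOnePair.plus_lt_iff _ _ _).1 (lt_of_le_of_lt (h c) h2)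
  le_plus_comp := by
    intro I₁ I₂ I hlt hI y
    have h := φ.minus_comp_le I₂.neg I₁.neg I.neg
      (fun x hx z hz => by have := hlt _ hz _ hx; linarith)
      (by
        ext x
        simp only [BddInterval.neg, hI, mem_ofPred_eq, mem_union]
        exact or_comm)
    refine le_of_forall_gt fun c hc => ?_
    have h1 := (DegOnePair.lt_minus_iff _ _ _).2 hc
    have h2 := (DegOnePair.lt_minus_iff _ _ _).2 h1
    exact (DegOnePair.lt_minus_iff _ _ _).1 (lt_of_lt_of_le h2 (h c))
  cadlag_left := by
    intro t ε hε
    have h := tendsto_neg_nhdsLT (a := t) |>.eventually (φ.cadlag_right (-t) ε hε)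
    filter_upwards [h] with s hs x
    rw [BddInterval.neg_ioo]
    exact ⟨DegOnePair.abs_inv_minus_sub_le _ (fun z => (hs z).2) x,
      DegOnePair.abs_inv_plus_sub_le _ (fun z => (hs z).1) x⟩
  cadlag_right := by
    intro t ε hε
    have h := tendsto_neg_nhdsGT (a := t) |>.eventually (φ.cadlag_left (-t) ε hε)
    filter_upwards [h] with s hs x
    rw [BddInterval.neg_ioo]
    exact ⟨DegOnePair.abs_inv_minus_sub_le _ (fun z => (hs z).2) x,
      DegOnePair.abs_inv_plus_sub_le _ (fun z => (hs z).1) x⟩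

/-- The σ-algebra on `D°(ℝ, 𝒟)` generated by the evaluations `φ ↦ φ_I⁺ x`; it is the Borel
σ-algebra of the usual metric on `D°(ℝ, 𝒟)`. -/
instance instMeasurableSpace : MeasurableSpace CadlagWeakFlow :=
  ⨆ I : BddInterval, MeasurableSpace.comap (fun φ : CadlagWeakFlow => φ.toFun I) inferInstance

theorem measurable_toFun (I : BddInterval) :
    Measurable (fun φ : CadlagWeakFlow => φ.toFun I) :=
  Measurable.of_comap_le (le_iSup (fun I : BddInterval =>
    MeasurableSpace.comap (fun φ : CadlagWeakFlow => φ.toFun I) inferInstance) I)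

theorem measurable_reversal : Measurable reversal := by
  rw [measurable_iff_comap_le]
  simp only [instMeasurableSpace, MeasurableSpace.comap_iSup, MeasurableSpace.comap_comp]
  exact iSup_le fun I =>
    (DegOnePair.measurable_inv.comp (measurable_toFun I.neg)).comap_le

end CadlagWeakFlow

/-- `N` is, under `P`, a Poisson random measure on `ℝ` of intensity `r` (times Lebesgue measure). -/
structure IsPoissonRandomMeasure {Ω : Type*} [MeasurableSpace Ω] (r : ℝ≥0) (P : Measure Ω)
    (N : Ω → Measure ℝ) : Prop where
  measurable : Measurable N
  map_eq : ∀ B : Set ℝ, MeasurableSet B → volume B ≠ ∞ →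
    P.map (fun ω => N ω B) =
      (poissonMeasure (r * (volume B).toNNReal)).map (fun k : ℕ => (k : ℝ≥0∞))
  indep : ∀ (n : ℕ) (B : Fin n → Set ℝ), (∀ i, MeasurableSet (B i)) →
    (∀ i j, i ≠ j → Disjoint (B i) (B j)) → iIndepFun (fun i ω => N ω (B i)) P

/-- The counting path of an (integer-valued) measure `ν`: `N_t = ν (0, t]` for `t ≥ 0` and
`N_t = -ν (t, 0]` for `t < 0`. -/
noncomputable def countingPath (ν : Measure ℝ) (t : ℝ) : ℤ :=
  if 0 ≤ t then ⌊(ν (Ioc 0 t)).toReal⌋ else -⌊(ν (Ioc t 0)).toReal⌋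

/-- The arrival times `t_n = inf {t : N_t ≥ n}`, `n ∈ ℤ`. -/
noncomputable def arrivalTime (ν : Measure ℝ) (n : ℤ) : ℝ := sInf {t : ℝ | n ≤ countingPath ν t}

/-- `compFrom f m k = f (m + k) ∘ ⋯ ∘ f (m + 1)`, a composition of `k` maps. -/
def compFrom (f : ℤ → ℝ → ℝ) (m : ℤ) : ℕ → ℝ → ℝ
  | 0 => fun x => x
  | k + 1 => fun x => f (m + k + 1) (compFrom f m k x)

/-- `g` is the pair `Φ_{n,m} = {F⁻_n ∘ ⋯ ∘ F⁻_{m+1}, F⁺_n ∘ ⋯ ∘ F⁺_{m+1}}` (the identity when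
`n = m`). -/
def IsDiscreteFlowMap (F : ℤ → DegOnePair) (n m : ℤ) (g : DegOnePair) : Prop :=
  g.minus = compFrom (fun k => (F k).minus) m (n - m).toNat ∧
  g.plus = compFrom (fun k => (F k).plus) m (n - m).toNat

/-- `φ` is the flow `φ_{(s,t]} = Φ_{N_t, N_s}` driven by the maps `F_n` and the counting path `N`;
`N_s` or `N_t` is replaced by the left limit `N_{s-}` or `N_{t-}` when the interval is closed on
the left or open on the right. -/
def IsDrivenFlow (N : ℝ → ℤ) (F : ℤ → DegOnePair) (φ : CadlagWeakFlow) : Prop :=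
  ∀ s t : ℝ, s ≤ t →
    IsDiscreteFlowMap F (N t) (N s) (φ.toFun (BddInterval.ioc s t)) ∧
    IsDiscreteFlowMap F (N t) (Function.leftLim N s) (φ.toFun (BddInterval.icc s t)) ∧
    (s < t → IsDiscreteFlowMap F (Function.leftLim N t) (N s)
      (φ.toFun (BddInterval.ioo s t))) ∧
    IsDiscreteFlowMap F (Function.leftLim N t) (Function.leftLim N s)
      (φ.toFun (BddInterval.ico s t))

/-- The class `𝒟*` of families `η = {η_{h,t} : h > 0, t ∈ ℝ}` of probability distributions on `𝒟`,
measurable in `t`, such that `F⁺ x = F⁻ x` almost surely under `η_{h,t}`, for all `h`, `t`, `x`. -/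
structure InDStar (η : ℝ → Kernel ℝ DegOnePair) : Prop where
  isMarkovKernel : ∀ h : ℝ, 0 < h → IsMarkovKernel (η h)
  plus_eq_minus : ∀ h : ℝ, 0 < h → ∀ t x : ℝ, ∀ᵐ f ∂(η h t), f.plus x = f.minus x

/-- The family of the laws of `G_{h,t} = (F_{h,-t})⁻¹`, where `F_{h,t}` has law `η_{h,t}`. -/
noncomputable def reversedInverse (η : ℝ → Kernel ℝ DegOnePair) : ℝ → Kernel ℝ DegOnePair :=
  fun h => ((η h).comap (fun t : ℝ => -t) measurable_neg).map DegOnePair.inv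

/-- `Φ` is, under `P`, a Poisson disturbance flow with disturbances of laws `η_{h,t}`: there are a
Poisson random measure `N` of intensity `h⁻¹` with arrival times `t_n`, and random maps `F_n` which,
given `N`, are independent with laws `η_{h,t_n}`, such that almost surely `Φ_{(s,t]} = Φ_{N_t,N_s}`
for all `s ≤ t`, and similarly for the other types of intervals. -/
def IsPoissonDisturbanceFlow {Ω : Type*} [MeasurableSpace Ω] (η : ℝ → Kernel ℝ DegOnePair)
    (h : ℝ) (P : Measure Ω) (Φ : Ω → CadlagWeakFlow) : Prop :=
  AEMeasurable Φ P ∧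
  ∃ (N : Ω → Measure ℝ) (F : ℤ → Ω → DegOnePair),
    IsPoissonRandomMeasure (Real.toNNReal h⁻¹) P N ∧
    (∀ n, Measurable (F n)) ∧
    (∀ A : Set (Measure ℝ), MeasurableSet A → ∀ S : Finset ℤ, ∀ B : ℤ → Set DegOnePair,
      (∀ n, MeasurableSet (B n)) →
      P {ω | N ω ∈ A ∧ ∀ n ∈ S, F n ω ∈ B n} =
        ∫⁻ ω in {ω | N ω ∈ A}, ∏ n ∈ S, η h (arrivalTime (N ω) n) (B n) ∂P) ∧
    ∀ᵐ ω ∂P, IsDrivenFlow (countingPath (N ω)) (fun n => F n ω) (Φ ω)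

/-- `μ` is the law `μ_A^{η_h}` on `D°(ℝ, 𝒟)` of a Poisson disturbance flow with disturbances of
laws `η_{h,t}`. -/
def IsDisturbanceFlowLaw (η : ℝ → Kernel ℝ DegOnePair) (h : ℝ) (μ : Measure CadlagWeakFlow) :
    Prop :=
  ∃ (Ω : Type) (_ : MeasurableSpace Ω) (P : Measure Ω) (Φ : Ω → CadlagWeakFlow),
    IsProbabilityMeasure P ∧ IsPoissonDisturbanceFlow η h P Φ ∧ μ = P.map Φ

/-! Reversal is pathwise. If `Φ` is driven by the point measure `N` and the maps `F n`, its reversal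
is driven by the reflection of `N` under `x ↦ -x` and the maps `(F (1 - n)).inv`. Inversion reverses
the order of composition, because each member of a pair is adjoint, for strict inequalities, to a
member of the inverse pair (`IsDiscreteFlowMap.inv`). Reflection turns the counting path into minus
its left limit at `-t` and, when `N` has no atom at 0, sends the arrival time `t_n` to `-t_{1-n}`
(`countingPath_map_neg`, `arrivalTime_map_neg`). A reflected Poisson random measure is Poisson with
the same intensity, so given it the new maps have the laws `reversedInverse η`.

Uniqueness of the law: intensity and kernel determine the joint law of `N` and the `F n`
(`map_prodMk_eq`). Since `N` almost surely does not charge a given endpoint, each evaluation of the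
flow is almost surely a fixed measurable function of `N` and the `F n` (`plus_eq_drivenValue`), so
the finite-dimensional laws of the evaluations are determined, and these characterise a law on the
flow space. -/

/-! ### Inverses of compositions. -/

theorem compFrom_succ' (f : ℤ → ℝ → ℝ) (m : ℤ) (k : ℕ) (x : ℝ) :
    compFrom f m (k + 1) x = compFrom f (m + 1) k (f (m + 1) x) := by
  induction k with
  | zero => simp [compFrom]
  | succ k ih =>
    change f (m + (k + 1 : ℕ) + 1) (compFrom f m (k + 1) x) =
      f (m + 1 + k + 1) (compFrom f (m + 1) k (f (m + 1) x))
    rw [ih]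
    congr 1
    push_cast
    ring

/-- The adjoint of a composition is the composition of the adjoints in reverse order: the outermost
`f` moves across first and becomes the innermost `g`. The indices `m + 1, …, m + k` go under `j ↦ 1
- j` to `-m, …, -m - k + 1`, so the second composition starts after `-m - k`. -/
theorem compFrom_lt_iff {f g : ℤ → ℝ → ℝ} (hfg : ∀ j x y, f j x < y ↔ x < g (1 - j) y)
    (m : ℤ) (k : ℕ) (x y : ℝ) : compFrom f m k x < y ↔ x < compFrom g (-m - k) k y := by
  induction k generalizing y with
  | zero => exact Iff.rfl
  | succ k ih =>
    rw [compFrom, hfg, ih, compFrom_succ']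
    have h1 : 1 - (m + k + 1) = -m - ((k + 1 : ℕ) : ℤ) + 1 := by push_cast; ring
    have h2 : -m - (k : ℤ) = -m - ((k + 1 : ℕ) : ℤ) + 1 := by push_cast; ring
    rw [h1, h2]

theorem compFrom_toNat_lt_iff {f g : ℤ → ℝ → ℝ} (hfg : ∀ j x y, f j x < y ↔ x < g (1 - j) y)
    (n m : ℤ) (x y : ℝ) :
    compFrom f m (n - m).toNat x < y ↔ x < compFrom g (-n) (n - m).toNat y := by
  rcases le_total m n with h | h
  · rw [compFrom_lt_iff hfg, Int.toNat_of_nonneg (by lia)]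
    have : -m - (n - m) = -n := by ring
    rw [this]
  · rw [Int.toNat_of_nonpos (by lia)]
    exact Iff.rfl

theorem IsDiscreteFlowMap.inv {F : ℤ → DegOnePair} {n m : ℤ} {g : DegOnePair}
    (hg : IsDiscreteFlowMap F n m g) :
    IsDiscreteFlowMap (fun k => (F (1 - k)).inv) (-m) (-n) g.inv := by
  have hnm : -m - -n = n - m := by ring
  constructor
  · funext y
    refine eq_of_forall_lt_iff fun x => ?_
    change x < g.invMinus y ↔ _
    rw [← g.plus_lt_iff, hg.2, hnm]
    refine compFrom_toNat_lt_iff (fun j x y => ?_) n m x y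
    change _ ↔ x < (F (1 - (1 - j))).invMinus y
    rw [sub_sub_cancel]
    exact (F j).plus_lt_iff x y
  · funext y
    refine eq_of_forall_gt_iff fun x => ?_
    change g.invPlus y < x ↔ _
    rw [← g.lt_minus_iff, hg.1]
    -- For the right-continuous inverse the adjunction has the inverse on the left, so the inverses
    -- play the role of `f` and the maps `(F k).minus` that of `g`.
    have h := compFrom_toNat_lt_iff (f := fun k => (F (1 - k)).inv.plus)
      (g := fun k => (F k).minus) (fun j x y => ((F (1 - j)).lt_minus_iff y x).symm) (-m) (-n) y x
    rw [neg_neg] at h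
    rw [h, hnm]

/-! ### Counting paths and arrival times under reflection. -/

/-- The measure `ν` takes finite integer values on the intervals `(a, b]`. -/
def IsIntegerValued (ν : Measure ℝ) : Prop := ∀ a b : ℝ, ∃ k : ℕ, ν (Ioc a b) = k

namespace IsIntegerValued

variable {ν : Measure ℝ}

theorem measure_Ioc_ne_top (hν : IsIntegerValued ν) (a b : ℝ) : ν (Ioc a b) ≠ ∞ := by
  obtain ⟨k, hk⟩ := hν a b
  simp [hk]

theorem measure_singleton_ne_top (hν : IsIntegerValued ν) (a : ℝ) : ν {a} ≠ ∞ :=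
  measure_ne_top_of_subset
    (singleton_subset_iff.2 (show a ∈ Ioc (a - 1) a from ⟨by linarith, le_rfl⟩))
    (hν.measure_Ioc_ne_top (a - 1) a)

theorem cast_floor (hν : IsIntegerValued ν) (a b : ℝ) :
    ((⌊(ν (Ioc a b)).toReal⌋ : ℤ) : ℝ) = ν.real (Ioc a b) := by
  obtain ⟨k, hk⟩ := hν a b
  simp [Measure.real, hk]

theorem real_Ioc_add (hν : IsIntegerValued ν) {a b c : ℝ} (hab : a ≤ b) (hbc : b ≤ c) :
    ν.real (Ioc a b) + ν.real (Ioc b c) = ν.real (Ioc a c) := by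
  rw [← Ioc_union_Ioc_eq_Ioc hab hbc, measureReal_union (Ioc_disjoint_Ioc_of_le le_rfl)
    measurableSet_Ioc (hν.measure_Ioc_ne_top _ _) (hν.measure_Ioc_ne_top _ _)]

theorem countingPath_sub (hν : IsIntegerValued ν) {s t : ℝ} (hst : s ≤ t) :
    (countingPath ν t : ℝ) - countingPath ν s = ν.real (Ioc s t) := by
  unfold countingPath
  split_ifs with h1 h2 h2
  · rw [hν.cast_floor, hν.cast_floor, ← hν.real_Ioc_add h2 hst]
    ring
  · push_cast
    rw [hν.cast_floor, hν.cast_floor, ← hν.real_Ioc_add (not_le.1 h2).le h1]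
    ring
  · linarith
  · push_cast
    rw [hν.cast_floor, hν.cast_floor, ← hν.real_Ioc_add hst (not_le.1 h1).le]
    ring

theorem monotone_countingPath (hν : IsIntegerValued ν) : Monotone (countingPath ν) := by
  intro s t hst
  have h := hν.countingPath_sub hst
  have h0 : 0 ≤ ν.real (Ioc s t) := measureReal_nonneg
  exact_mod_cast (by linarith : (countingPath ν s : ℝ) ≤ countingPath ν t)

theorem tendsto_countingPath_nhdsLT (hν : IsIntegerValued ν) (s : ℝ) :
    Tendsto (fun t => (countingPath ν t : ℝ)) (𝓝[<] s) (𝓝 (countingPath ν s - ν.real {s})) := by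
  -- Continuity from above: the intervals `(s - r, s]` have finite mass and shrink to `{s}`.
  have h1 : Tendsto (ν ∘ fun r : ℝ => Ioc (s - r) s) (𝓝[>] 0)
      (𝓝 (ν (⋂ r > (0 : ℝ), Ioc (s - r) s))) := by
    refine tendsto_measure_biInter_gt (fun r _ => measurableSet_Ioc.nullMeasurableSet)
      (fun i j _ hij => Ioc_subset_Ioc_left (by linarith))
      ⟨1, one_pos, hν.measure_Ioc_ne_top _ _⟩
  have h2 : ⋂ r > (0 : ℝ), Ioc (s - r) s = {s} := by
    ext x
    simp only [gt_iff_lt, mem_iInter, mem_Ioc, mem_singleton_iff]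
    constructor
    · intro h
      refine le_antisymm (h 1 one_pos).2 (le_of_not_gt fun hx => ?_)
      have := (h (s - x) (by linarith)).1
      linarith
    · rintro rfl r hr
      exact ⟨by linarith, le_rfl⟩
  rw [h2] at h1
  have hs : ν {s} ≠ ∞ := hν.measure_singleton_ne_top s
  have h3 : Tendsto (fun t : ℝ => s - t) (𝓝[<] s) (𝓝[>] 0) := by
    refine tendsto_nhdsWithin_iff.2 ⟨?_, ?_⟩
    · have : Tendsto (fun t : ℝ => s - t) (𝓝 s) (𝓝 (s - s)) := tendsto_const_nhds.sub tendsto_id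
      rw [sub_self] at this
      exact this.mono_left nhdsWithin_le_nhds
    · filter_upwards [self_mem_nhdsWithin] with t ht
      simpa using ht
  have h4 := ((ENNReal.tendsto_toReal hs).comp (h1.comp h3)).const_sub (countingPath ν s : ℝ)
  refine h4.congr' ?_
  filter_upwards [self_mem_nhdsWithin] with t ht
  have := hν.countingPath_sub (le_of_lt ht)
  simp only [Function.comp_apply, sub_sub_cancel]
  rw [Measure.real] at this
  linarith

theorem leftLim_countingPath (hν : IsIntegerValued ν) (s : ℝ) :
    ((Function.leftLim (countingPath ν) s : ℤ) : ℝ) = countingPath ν s - ν.real {s} := by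
  have h := (Int.isClosedEmbedding_coe_real.continuous.tendsto _).comp
    (hν.monotone_countingPath.tendsto_leftLim s)
  exact tendsto_nhds_unique h (hν.tendsto_countingPath_nhdsLT s)

theorem leftLim_countingPath_of_null (hν : IsIntegerValued ν) {s : ℝ} (hs : ν {s} = 0) :
    Function.leftLim (countingPath ν) s = countingPath ν s := by
  have h := hν.leftLim_countingPath s
  rw [Measure.real, hs, ENNReal.toReal_zero, sub_zero] at h
  exact_mod_cast h

theorem real_Icc (hν : IsIntegerValued ν) {a b : ℝ} (hab : a ≤ b) :
    ν.real (Icc a b) = ν.real {a} + ν.real (Ioc a b) := by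
  have hs : ν {a} ≠ ∞ := hν.measure_singleton_ne_top a
  have hd : Disjoint {a} (Ioc a b) := by simp
  rw [← Icc_union_Ioc_eq_Icc le_rfl hab, Icc_self,
    measureReal_union hd measurableSet_Ioc hs (hν.measure_Ioc_ne_top _ _)]

/-- Reflection carries `(a, b]` to `[-b, -a)`, so the endpoint that is counted changes; this
produces the left limit. Both paths are normalised at time 0, and without `h0` the two sides would
differ by the mass of `{0}`. -/
theorem countingPath_map_neg (hν : IsIntegerValued ν) (hν' : IsIntegerValued (ν.map (fun x => -x)))
    (h0 : ν {0} = 0) (t : ℝ) :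
    countingPath (ν.map (fun x => -x)) t = -Function.leftLim (countingPath ν) (-t) := by
  have hreal : ∀ a b : ℝ, (ν.map (fun x => -x)).real (Ioc a b) = ν.real (Ico (-b) (-a)) := by
    intro a b
    rw [Measure.real, Measure.real, Measure.map_apply measurable_neg measurableSet_Ioc]
    congr 2
    ext x
    simp only [mem_preimage, mem_Ioc, mem_Ico]
    constructor <;> rintro ⟨h1, h2⟩ <;> constructor <;> linarith
  have hlim := hν.leftLim_countingPath (-t)
  have hc0 : countingPath ν 0 = 0 := by simp [countingPath]
  have key : (countingPath (ν.map (fun x => -x)) t : ℝ) =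
      -((Function.leftLim (countingPath ν) (-t) : ℤ) : ℝ) := by
    rw [hlim]
    have hc0' : countingPath (ν.map (fun x => -x)) 0 = 0 := by simp [countingPath]
    rcases le_total 0 t with ht | ht
    · have h1 := hν'.countingPath_sub ht
      have h2 := hν.countingPath_sub (s := -t) (t := 0) (by linarith)
      have h3 := hν.real_Icc (a := -t) (b := 0) (by linarith)
      have h4 : ν.real (Icc (-t) 0) = ν.real (Ico (-t) 0) := by
        rw [Measure.real, Measure.real, ← Ico_union_right (by linarith : -t ≤ 0)]
        exact congrArg _ (le_antisymm ((measure_union_le _ _).trans (by rw [h0, add_zero]))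
          (measure_mono subset_union_left))
      rw [hreal, neg_zero] at h1
      rw [hc0] at h2
      rw [hc0'] at h1
      push_cast at h1 h2
      linarith
    · have h1 := hν'.countingPath_sub ht
      have h2 := hν.countingPath_sub (s := 0) (t := -t) (by linarith)
      have h3 : ν.real (Ioc 0 (-t)) = ν.real (Icc 0 (-t)) := by
        rw [hν.real_Icc (by linarith), Measure.real, Measure.real, h0]
        simp
      have hfin : ν (Ico 0 (-t)) ≠ ∞ :=
        measure_ne_top_of_subset (show Ico 0 (-t) ⊆ Ioc (-1) (-t) from
          fun x hx => ⟨by linarith [hx.1], hx.2.le⟩) (hν.measure_Ioc_ne_top _ _)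
      have hs : ν {-t} ≠ ∞ := hν.measure_singleton_ne_top (-t)
      have h4 : ν.real (Icc 0 (-t)) = ν.real (Ico 0 (-t)) + ν.real {-t} := by
        rw [← measureReal_union (by simp) (measurableSet_singleton _) hfin hs,
          Ico_union_right (by linarith)]
      rw [hreal, neg_zero] at h1
      rw [hc0] at h2
      rw [hc0'] at h1
      push_cast at h1 h2
      linarith
  exact_mod_cast key

/-- For integers, `n ≤ -a` means `a < 1 - n`, which is the source of the index `1 - n`. The sets
where `N_{s-} < 1 - n` and where `N_s ≥ 1 - n` cover the line, the first lying to the left of the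
second, so the supremum of the first is the infimum of the second. -/
theorem arrivalTime_map_neg (hν : IsIntegerValued ν) (hν' : IsIntegerValued (ν.map (fun x => -x)))
    (h0 : ν {0} = 0) (n : ℤ) :
    arrivalTime (ν.map (fun x => -x)) n = -arrivalTime ν (1 - n) := by
  set c := countingPath ν with hc
  have hmono : Monotone c := hν.monotone_countingPath
  have hset : {t : ℝ | n ≤ countingPath (ν.map (fun x => -x)) t} =
      -{s : ℝ | Function.leftLim c s < 1 - n} := by
    ext t
    rw [Set.mem_neg, mem_ofPred_eq, mem_ofPred_eq, hν.countingPath_map_neg hν' h0]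
    lia
  have hU : {s : ℝ | Function.leftLim c s < 1 - n} ∪ {s : ℝ | 1 - n ≤ c s} = univ := by
    refine eq_univ_of_forall fun s => ?_
    rcases lt_or_ge (c s) (1 - n) with h | h
    · exact Or.inl (lt_of_le_of_lt (hmono.leftLim_le le_rfl) h)
    · exact Or.inr h
  have hlt : ∀ s, Function.leftLim c s < 1 - n → ∀ t, 1 - n ≤ c t → s ≤ t := by
    intro s hs t ht
    by_contra! hts
    exact absurd (ht.trans (hmono.le_leftLim hts)) (not_le.2 hs)
  unfold arrivalTime
  rw [hset, Real.sInf_neg, neg_inj]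
  rcases eq_empty_or_nonempty {s : ℝ | 1 - n ≤ c s} with hE | hE
  -- When one set is empty the other is the whole line, and `sInf` and `sSup` of both take the
  -- default value 0. Hence the identity needs no assumption that the points are infinite in number
  -- on either side.
  · rw [hE, union_empty] at hU
    rw [← hc, hE, hU]
    simp
  · rcases eq_empty_or_nonempty {s : ℝ | Function.leftLim c s < 1 - n} with hE' | hE'
    · rw [hE', empty_union] at hU
      rw [← hc, hE', hU]
      simp
    · refine le_antisymm (csSup_le hE' fun s hs => le_csInf hE fun t ht => hlt s hs t ht) ?_
      refine le_of_forall_lt fun x hx => ?_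
      obtain ⟨y, hxy, hy⟩ := exists_between hx
      obtain ⟨s₀, hs₀⟩ := hE'
      have hy' : ¬ 1 - n ≤ c y := fun h => absurd (csInf_le ⟨s₀, fun t ht => hlt s₀ hs₀ t ht⟩ h)
        (not_le.2 hy)
      obtain ⟨t₀, ht₀⟩ := hE
      exact hxy.trans_le (le_csSup ⟨t₀, fun s hs => hlt s hs t₀ ht₀⟩
        (lt_of_le_of_lt (hmono.leftLim_le le_rfl) (not_le.1 hy')))

end IsIntegerValued

/-! ### Reflection of intervals and of driven flows. -/

namespace BddInterval

theorem neg_ioc (s t : ℝ) : (ioc s t).neg = ico (-t) (-s) := by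
  refine Subtype.ext (Set.ext fun x => ?_)
  simp only [neg, ioc, ico, mem_ofPred_eq, mem_Ioc, mem_Ico]
  constructor <;> rintro ⟨h1, h2⟩ <;> constructor <;> linarith

theorem neg_ico (s t : ℝ) : (ico s t).neg = ioc (-t) (-s) := by
  refine Subtype.ext (Set.ext fun x => ?_)
  simp only [neg, ioc, ico, mem_ofPred_eq, mem_Ioc, mem_Ico]
  constructor <;> rintro ⟨h1, h2⟩ <;> constructor <;> linarith

theorem neg_icc (s t : ℝ) : (icc s t).neg = icc (-t) (-s) := by
  refine Subtype.ext (Set.ext fun x => ?_)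
  simp only [neg, icc, mem_ofPred_eq, mem_Icc]
  constructor <;> rintro ⟨h1, h2⟩ <;> constructor <;> linarith

/-- A bounded interval is empty or of one of the four usual types. -/
theorem cases_eq (I : BddInterval) : I.1 = ∅ ∨ ∃ s t : ℝ, s = sInf I.1 ∧ t = sSup I.1 ∧ s ≤ t ∧
    (I = icc s t ∨ I = ico s t ∨ I = ioc s t ∨ (s < t ∧ I = ioo s t)) := by
  rcases eq_empty_or_nonempty I.1 with hE | hE
  · exact Or.inl hE
  · refine Or.inr ⟨sInf I.1, sSup I.1, rfl, rfl, Real.sInf_le_sSup _ I.2.2.bddBelow I.2.2.bddAbove, ?_⟩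
    have h1 : Ioo (sInf I.1) (sSup I.1) ⊆ I.1 := by
      intro x hx
      obtain ⟨a, ha, hax⟩ := exists_lt_of_csInf_lt hE hx.1
      obtain ⟨b, hb, hxb⟩ := exists_lt_of_lt_csSup hE hx.2
      exact I.2.1.out ha hb ⟨hax.le, hxb.le⟩
    have h2 : I.1 ⊆ Icc (sInf I.1) (sSup I.1) := fun x hx =>
      ⟨csInf_le I.2.2.bddBelow hx, le_csSup I.2.2.bddAbove hx⟩
    have h3 := mem_Icc_Ico_Ioc_Ioo_of_subset_of_subset h1 h2
    simp only [mem_insert_iff, mem_singleton_iff] at h3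
    rcases h3 with h | h | h | h
    · exact Or.inl (Subtype.ext h)
    · exact Or.inr (Or.inl (Subtype.ext h))
    · exact Or.inr (Or.inr (Or.inl (Subtype.ext h)))
    · refine Or.inr (Or.inr (Or.inr ⟨?_, Subtype.ext h⟩))
      rw [h] at hE
      exact nonempty_Ioo.1 hE

end BddInterval

/-- Reflection exchanges `(s, t]` with `[s, t)` and preserves closed and open intervals, just as `h`
and `h'` exchange values of the counting path with left limits. -/
theorem IsDrivenFlow.reversal {N N' : ℝ → ℤ} {F : ℤ → DegOnePair} {φ : CadlagWeakFlow}
    (hφ : IsDrivenFlow N F φ) (h : ∀ t, N' t = -Function.leftLim N (-t))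
    (h' : ∀ t, Function.leftLim N' t = -N (-t)) :
    IsDrivenFlow N' (fun k => (F (1 - k)).inv) φ.reversal := by
  intro s t hst
  have hφ' := hφ (-t) (-s) (neg_le_neg hst)
  simp only [CadlagWeakFlow.reversal, BddInterval.neg_ioc, BddInterval.neg_icc,
    BddInterval.neg_ioo, BddInterval.neg_ico, h, h']
  exact ⟨hφ'.2.2.2.inv, hφ'.2.1.inv, fun hlt => (hφ'.2.2.1 (neg_lt_neg hlt)).inv, hφ'.1.inv⟩

/-! ### Sample properties and law of a Poisson random measure. -/

/-- Reduction to countably many intervals, so that integrality holds almost surely for all of them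
at once. A real right endpoint is approached from above by rationals, and `ℕ` is closed in `ℝ`; a
real left endpoint is then reached by subtraction. -/
theorem isIntegerValued_of_rat {ν : Measure ℝ} (h : ∀ a b : ℚ, ∃ k : ℕ, ν (Ioc (a : ℝ) b) = k) :
    IsIntegerValued ν := by
  have hfin : ∀ a b : ℝ, ν (Ioc a b) ≠ ∞ := by
    intro a b
    obtain ⟨q, hq⟩ := exists_rat_lt a
    obtain ⟨r, hr⟩ := exists_rat_gt b
    obtain ⟨k, hk⟩ := h q r
    exact measure_ne_top_of_subset (Ioc_subset_Ioc hq.le hr.le) (by simp [hk])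
  have hstep : ∀ (q : ℚ) (b : ℝ), ∃ k : ℕ, ν (Ioc (q : ℝ) b) = k := by
    intro q b
    have h1 : Tendsto (ν ∘ fun r : ℝ => Ioc (q : ℝ) r) (𝓝[>] b)
        (𝓝 (ν (⋂ r > b, Ioc (q : ℝ) r))) :=
      tendsto_measure_biInter_gt (fun r _ => measurableSet_Ioc.nullMeasurableSet)
        (fun i j _ hij => Ioc_subset_Ioc_right hij) ⟨b + 1, by simp, hfin _ _⟩
    have h2 : ⋂ r > b, Ioc (q : ℝ) r = Ioc (q : ℝ) b := by
      ext x
      simp only [gt_iff_lt, mem_iInter, mem_Ioc]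
      constructor
      · intro hx
        exact ⟨(hx (b + 1) (by simp)).1, le_of_forall_gt_imp_ge_of_dense fun r hr => (hx r hr).2⟩
      · exact fun hx r hr => ⟨hx.1, hx.2.trans hr.le⟩
    rw [h2] at h1
    have h3 := (ENNReal.tendsto_toReal (hfin q b)).comp h1
    have h4 : ∃ᶠ r in 𝓝[>] b, (ENNReal.toReal ∘ (ν ∘ fun r : ℝ => Ioc (q : ℝ) r)) r ∈
        range ((↑) : ℕ → ℝ) := by
      rw [frequently_iff]
      intro U hU
      obtain ⟨u, hu, hsub⟩ := mem_nhdsGT_iff_exists_Ioo_subset.1 hU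
      obtain ⟨r, hr1, hr2⟩ := exists_rat_btwn (show b < u from hu)
      obtain ⟨k, hk⟩ := h q r
      exact ⟨r, hsub ⟨hr1, hr2⟩, k, by simp [hk]⟩
    obtain ⟨k, hk⟩ := Nat.isClosedEmbedding_coe_real.isClosed_range.mem_of_frequently_of_tendsto
      h4 h3
    exact ⟨k, by rw [← ENNReal.ofReal_toReal (hfin q b), ← hk, ENNReal.ofReal_natCast]⟩
  intro a b
  rcases le_or_gt b a with hba | hab
  · exact ⟨0, by simp [Ioc_eq_empty_of_le hba]⟩
  · obtain ⟨q, hq⟩ := exists_rat_lt a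
    obtain ⟨k, hk⟩ := hstep q a
    obtain ⟨l, hl⟩ := hstep q b
    have hd : ν (Ioc (q : ℝ) a ∪ Ioc a b) = ν (Ioc (q : ℝ) a) + ν (Ioc a b) :=
      measure_union (Ioc_disjoint_Ioc_of_le le_rfl) measurableSet_Ioc
    rw [Ioc_union_Ioc_eq_Ioc hq.le hab.le, hk, hl] at hd
    refine ⟨l - k, ?_⟩
    rw [ENNReal.natCast_sub, hd, ENNReal.add_sub_cancel_left (by simp)]

namespace IsPoissonRandomMeasure

variable {Ω : Type*} [MeasurableSpace Ω] {r : ℝ≥0} {P : Measure Ω} {N : Ω → Measure ℝ}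

theorem measurable_apply (hN : IsPoissonRandomMeasure r P N) {B : Set ℝ} (hB : MeasurableSet B) :
    Measurable fun ω => N ω B :=
  (Measure.measurable_coe hB).comp hN.measurable

theorem ae_isIntegerValued (hN : IsPoissonRandomMeasure r P N) :
    ∀ᵐ ω ∂P, IsIntegerValued (N ω) := by
  have h : ∀ a b : ℚ, ∀ᵐ ω ∂P, ∃ k : ℕ, N ω (Ioc (a : ℝ) b) = k := by
    intro a b
    have hms : MeasurableSet {x : ℝ≥0∞ | ∃ k : ℕ, x = k} := by
      have : {x : ℝ≥0∞ | ∃ k : ℕ, x = k} = range ((↑) : ℕ → ℝ≥0∞) := by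
        ext x
        simp [eq_comm]
      rw [this]
      exact (countable_range _).measurableSet
    have h1 : ∀ᵐ x ∂(P.map fun ω => N ω (Ioc (a : ℝ) b)), ∃ k : ℕ, x = (k : ℝ≥0∞) := by
      rw [hN.map_eq _ measurableSet_Ioc (by simp)]
      rw [ae_map_iff (measurable_of_countable _).aemeasurable hms]
      exact Eventually.of_forall fun k => ⟨k, rfl⟩
    exact (ae_map_iff (hN.measurable_apply measurableSet_Ioc).aemeasurable hms).1 h1
  have h' : ∀ᵐ ω ∂P, ∀ a b : ℚ, ∃ k : ℕ, N ω (Ioc (a : ℝ) b) = k :=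
    ae_all_iff.2 fun a => ae_all_iff.2 fun b => h a b
  filter_upwards [h'] with ω hω using isIntegerValued_of_rat hω

/-- A point has Lebesgue measure 0, so its count is Poisson with parameter 0. -/
theorem ae_singleton_eq_zero (hN : IsPoissonRandomMeasure r P N) (s : ℝ) :
    ∀ᵐ ω ∂P, N ω {s} = 0 := by
  have h0 : ∀ᵐ k ∂(poissonMeasure 0), k = 0 := by
    have h1 : poissonMeasure 0 ({0} : Set ℕ) = 1 := by simp [poissonMeasure_singleton]
    exact (prob_compl_eq_zero_iff (measurableSet_singleton 0)).2 h1
  have h1 : ∀ᵐ x ∂(P.map fun ω => N ω {s}), x = 0 := by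
    rw [hN.map_eq _ (measurableSet_singleton s) (by simp)]
    refine (ae_map_iff (p := fun x : ℝ≥0∞ => x = 0) (measurable_of_countable _).aemeasurable
      (measurableSet_singleton 0)).2 ?_
    simpa using h0
  exact (ae_map_iff (p := fun x : ℝ≥0∞ => x = 0)
    (hN.measurable_apply (measurableSet_singleton s)).aemeasurable (measurableSet_singleton 0)).1 h1

theorem map_neg (hN : IsPoissonRandomMeasure r P N) :
    IsPoissonRandomMeasure r P (fun ω => (N ω).map (fun x => -x)) where
  measurable := (Measure.measurable_map _ measurable_neg).comp hN.measurable
  map_eq B hB hv := by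
    have hvol : volume ((fun x : ℝ => -x) ⁻¹' B) = volume B :=
      (Measure.measurePreserving_neg volume).measure_preimage hB.nullMeasurableSet
    simp_rw [Measure.map_apply measurable_neg hB]
    rw [hN.map_eq _ (measurable_neg hB) (by rwa [hvol]), hvol]
  indep n B hB hd := by
    simp_rw [fun (ω : Ω) (i : Fin n) => Measure.map_apply (μ := N ω) measurable_neg (hB i)]
    exact hN.indep n _ (fun i => measurable_neg (hB i)) fun i j hij => (hd i j hij).preimage _

theorem iIndepFun_of_disjoint (hN : IsPoissonRandomMeasure r P N) {ι : Type*} [Finite ι]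
    {B : ι → Set ℝ} (hB : ∀ i, MeasurableSet (B i)) (hd : ∀ i j, i ≠ j → Disjoint (B i) (B j)) :
    iIndepFun (fun i ω => N ω (B i)) P := by
  obtain ⟨n, ⟨e⟩⟩ := Finite.exists_equiv_fin ι
  have h := hN.indep n (fun k => B (e.symm k)) (fun k => hB _)
    (fun k l hkl => hd _ _ (e.symm.injective.ne hkl))
  simpa using h.precomp e.injective

variable {Ω' : Type*} [MeasurableSpace Ω'] {P' : Measure Ω'} {N' : Ω' → Measure ℝ}

theorem map_eval_eq_of_disjoint (hN : IsPoissonRandomMeasure r P N)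
    (hN' : IsPoissonRandomMeasure r P' N') {ι : Type*} [Fintype ι]
    {B : ι → Set ℝ} (hB : ∀ i, MeasurableSet (B i)) (hv : ∀ i, volume (B i) ≠ ∞)
    (hd : ∀ i j, i ≠ j → Disjoint (B i) (B j)) :
    P.map (fun ω i => N ω (B i)) = P'.map (fun ω i => N' ω (B i)) := by
  rw [(hN.iIndepFun_of_disjoint hB hd).map_fun_eq_pi_map
      fun i => (hN.measurable_apply (hB i)).aemeasurable,
    (hN'.iIndepFun_of_disjoint hB hd).map_fun_eq_pi_map
      fun i => (hN'.measurable_apply (hB i)).aemeasurable]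
  simp_rw [hN.map_eq _ (hB _) (hv _), hN'.map_eq _ (hB _) (hv _)]

/-- The sets `B i` are cut into the disjoint atoms of the algebra they generate, and each count is a
sum of counts of atoms. Only atoms with nonempty `T` enter, since the complement of all the `B i`
may have infinite volume. -/
theorem map_eval_eq (hN : IsPoissonRandomMeasure r P N) (hN' : IsPoissonRandomMeasure r P' N')
    {ι : Type*} [Fintype ι] {B : ι → Set ℝ} (hB : ∀ i, MeasurableSet (B i))
    (hv : ∀ i, volume (B i) ≠ ∞) :
    P.map (fun ω i => N ω (B i)) = P'.map (fun ω i => N' ω (B i)) := by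
  classical
  let A : {T : Finset ι // T.Nonempty} → Set ℝ := fun T => {x | ∀ i, x ∈ B i ↔ i ∈ T.1}
  have hA : ∀ T, MeasurableSet (A T) := by
    intro T
    have : A T = ⋂ i, {x | x ∈ B i ↔ i ∈ T.1} := by
      ext x
      simp [A]
    rw [this]
    refine MeasurableSet.iInter fun i => ?_
    by_cases hi : i ∈ T.1
    · simpa [hi] using hB i
    · simp only [hi, iff_false]
      exact (hB i).compl
  have hAv : ∀ T, volume (A T) ≠ ∞ := by
    intro T
    obtain ⟨i, hi⟩ := T.2
    exact measure_ne_top_of_subset (fun x hx => (hx i).2 hi) (hv i)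
  have hAd : ∀ T T', T ≠ T' → Disjoint (A T) (A T') := by
    intro T T' hTT'
    rw [Set.disjoint_left]
    intro x hx hx'
    exact hTT' (Subtype.ext (Finset.ext fun i => (hx i).symm.trans (hx' i)))
  have hBA : ∀ i, B i = ⋃ T ∈ (Finset.univ.filter fun T : {T : Finset ι // T.Nonempty} =>
      i ∈ T.1), A T := by
    intro i
    ext x
    simp only [Finset.mem_filter, Finset.mem_univ, true_and, mem_iUnion, exists_prop]
    constructor
    · intro hx
      exact ⟨⟨Finset.univ.filter fun j => x ∈ B j, ⟨i, by simpa using hx⟩⟩, by simpa using hx,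
        fun j => by simp⟩
    · rintro ⟨T, hiT, hxT⟩
      exact (hxT i).2 hiT
  let g : ({T : Finset ι // T.Nonempty} → ℝ≥0∞) → ι → ℝ≥0∞ := fun v i =>
    ∑ T ∈ Finset.univ.filter (fun T : {T : Finset ι // T.Nonempty} => i ∈ T.1), v T
  have hg : Measurable g := by
    refine measurable_pi_lambda _ fun i => Finset.measurable_sum _ fun T _ => measurable_pi_apply T
  have hsum : ∀ ν : Measure ℝ, (fun i => ν (B i)) = g fun T => ν (A T) := by
    intro ν
    funext i
    rw [hBA i, measure_biUnion_finset (fun T _ T' _ h => hAd T T' h) fun T _ => hA T]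
  have h := congrArg (Measure.map g) (hN.map_eval_eq_of_disjoint hN' hA hAv hAd)
  rw [Measure.map_map hg (measurable_pi_lambda _ fun T => hN.measurable_apply (hA T)),
    Measure.map_map hg (measurable_pi_lambda _ fun T => hN'.measurable_apply (hA T))] at h
  convert h using 2
  · exact funext fun ω => hsum (N ω)
  · exact funext fun ω => hsum (N' ω)

end IsPoissonRandomMeasure

/-- Two random elements of a space whose `σ`-algebra is generated by a family of measurable
functions have the same law as soon as the finite-dimensional laws of this family agree. -/
theorem map_eq_map_of_finiteDimensional {Ω Ω' X ι : Type*} {β : ι → Type*} [MeasurableSpace Ω]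
    [MeasurableSpace Ω'] [mX : MeasurableSpace X] [∀ i, MeasurableSpace (β i)] {P : Measure Ω}
    {P' : Measure Ω'} [IsProbabilityMeasure P] [IsProbabilityMeasure P'] {e : X → ∀ i, β i}
    (he : Measurable e) (hX : mX ≤ MeasurableSpace.comap e inferInstance) {Y : Ω → X} {Y' : Ω' → X}
    (hY : AEMeasurable Y P) (hY' : AEMeasurable Y' P')
    (h : ∀ J : Finset ι, P.map (fun ω (i : J) => e (Y ω) i) = P'.map fun ω (i : J) => e (Y' ω) i) :
    P.map Y = P'.map Y' := by
  have hprob := Measure.isProbabilityMeasure_map hY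
  have hprob' := Measure.isProbabilityMeasure_map hY'
  have hlim : (P.map Y).map e = (P'.map Y').map e := by
    have := Measure.isProbabilityMeasure_map (μ := P'.map Y') he.aemeasurable
    have hJ : ∀ J : Finset ι,
        IsFiniteMeasure (((P'.map Y').map e).map (J.restrict (π := β))) := fun J => inferInstance
    -- A finite measure on a product is determined by its finite marginals.
    refine IsProjectiveLimit.unique (P := fun J => ((P'.map Y').map e).map J.restrict) ?_
      fun J => rfl
    intro J
    have hr : Measurable (J.restrict (π := β)) := Finset.measurable_restrict J
    change _ = ((P'.map Y').map e).map J.restrict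
    rw [Measure.map_map hr he, Measure.map_map hr he,
      AEMeasurable.map_map_of_aemeasurable (hr.comp he).aemeasurable hY,
      AEMeasurable.map_map_of_aemeasurable (hr.comp he).aemeasurable hY']
    exact h J
  refine Measure.ext fun A hA => ?_
  obtain ⟨A', hA', rfl⟩ := hX _ hA
  rw [← Measure.map_apply he hA', ← Measure.map_apply he hA', hlim]

theorem IsPoissonRandomMeasure.map_eq_map {Ω Ω' : Type*} [MeasurableSpace Ω] [MeasurableSpace Ω']
    {r : ℝ≥0} {P : Measure Ω} {P' : Measure Ω'} [IsProbabilityMeasure P] [IsProbabilityMeasure P']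
    {N : Ω → Measure ℝ} {N' : Ω' → Measure ℝ} (hN : IsPoissonRandomMeasure r P N)
    (hN' : IsPoissonRandomMeasure r P' N') : P.map N = P'.map N' := by
  let e : Measure ℝ → {B : Set ℝ // MeasurableSet B ∧ volume B ≠ ∞} → ℝ≥0∞ := fun ν B => ν B.1
  have he : Measurable e := measurable_pi_lambda _ fun B => Measure.measurable_coe B.2.1
  refine map_eq_map_of_finiteDimensional he ?_ hN.measurable.aemeasurable
    hN'.measurable.aemeasurable fun J =>
      hN.map_eval_eq hN' (fun i => i.1.2.1) fun i => i.1.2.2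
  refine iSup₂_le fun B hB => ?_
  rw [← measurable_iff_comap_le]
  -- Sets of finite volume suffice to generate the σ-algebra on measures: any `B` is exhausted by
  -- the sets `B ∩ [-n, n]`.
  have hsup : (fun ν : Measure ℝ => ν B) =
      fun ν => ⨆ n : ℕ, ν (B ∩ Icc (-(n : ℝ)) n) := by
    funext ν
    rw [← Monotone.measure_iUnion, ← inter_iUnion]
    · congr 1
      rw [iUnion_eq_univ_iff.2, inter_univ]
      intro x
      obtain ⟨n, hn⟩ := exists_nat_ge |x|
      exact ⟨n, abs_le.1 hn⟩
    · intro m n hmn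
      have : (m : ℝ) ≤ n := by exact_mod_cast hmn
      exact inter_subset_inter_right _ (Icc_subset_Icc (neg_le_neg this) this)
  rw [hsup]
  refine Measurable.iSup fun n => ?_
  have hB' : MeasurableSet (B ∩ Icc (-(n : ℝ)) n) ∧ volume (B ∩ Icc (-(n : ℝ)) n) ≠ ∞ :=
    ⟨hB.inter measurableSet_Icc, measure_ne_top_of_subset inter_subset_right (by simp)⟩
  exact (measurable_pi_apply (⟨_, hB'⟩ : {B : Set ℝ // MeasurableSet B ∧ volume B ≠ ∞})).comp
    (comap_measurable e)

/-! ### Measurability of arrival times and flow values. -/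

theorem measurable_countingPath (t : ℝ) : Measurable fun ν : Measure ℝ => countingPath ν t := by
  unfold countingPath
  split_ifs
  · exact (Measure.measurable_coe measurableSet_Ioc).ennreal_toReal.floor
  · exact (Measure.measurable_coe measurableSet_Ioc).ennreal_toReal.floor.neg

/-- The infimum of an upper set of reals, as a countable infimum over the rationals. -/
theorem toReal_iInf_rat {U : Set ℝ} [∀ q : ℚ, Decidable ((q : ℝ) ∈ U)] (hU : IsUpperSet U) :
    (⨅ q : ℚ, if (q : ℝ) ∈ U then ((q : ℝ) : EReal) else ⊤).toReal = sInf U := by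
  -- The infimum is taken in `EReal` so that default values match: an empty set gives `⊤`, a set
  -- unbounded below gives `⊥`, and `toReal` sends both to 0, as `sInf` does.
  rcases eq_empty_or_nonempty U with rfl | hne
  · simp
  by_cases hb : BddBelow U
  · have h : (⨅ q : ℚ, if (q : ℝ) ∈ U then ((q : ℝ) : EReal) else ⊤) = ((sInf U : ℝ) : EReal) := by
      refine le_antisymm ?_ (le_iInf fun q => ?_)
      · refine le_of_forall_gt fun c hc => ?_
        obtain ⟨q, hq1, hq2⟩ := EReal.lt_iff_exists_rat_btwn.1 hc
        obtain ⟨u, hu, huq⟩ := exists_lt_of_csInf_lt hne (EReal.coe_lt_coe_iff.1 hq1)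
        refine (iInf_le _ q).trans_lt ?_
        rw [if_pos (hU huq.le hu)]
        exact hq2
      · split_ifs with hq
        · exact EReal.coe_le_coe_iff.2 (csInf_le hb hq)
        · exact le_top
    rw [h, EReal.toReal_coe]
  · have h : (⨅ q : ℚ, if (q : ℝ) ∈ U then ((q : ℝ) : EReal) else ⊤) = ⊥ := by
      refine eq_bot_iff.2 (le_of_forall_gt fun c hc => ?_)
      obtain ⟨q, hq1, hq2⟩ := EReal.lt_iff_exists_rat_btwn.1 hc
      obtain ⟨u, hu, huq⟩ := not_bddBelow_iff.1 hb q
      refine (iInf_le _ q).trans_lt ?_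
      rw [if_pos (hU huq.le hu)]
      exact hq2
    rw [h, Real.sInf_of_not_bddBelow hb, EReal.toReal_bot]

/-- The infimum over real times reduces to rational times when the counting path is monotone, which
is known for integer-valued measures; hence agreement with a measurable function is asserted only
there. -/
theorem exists_measurable_eq_arrivalTime (n : ℤ) : ∃ g : Measure ℝ → ℝ, Measurable g ∧
    ∀ ν, IsIntegerValued ν → arrivalTime ν n = g ν := by
  classical
  have hU : ∀ ν, IsIntegerValued ν → IsUpperSet {t : ℝ | n ≤ countingPath ν t} :=
    fun ν hν s t hst hs => le_trans (show n ≤ countingPath ν s from hs)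
      (hν.monotone_countingPath hst)
  refine ⟨fun ν => (⨅ q : ℚ, if (q : ℝ) ∈ {t : ℝ | n ≤ countingPath ν t} then ((q : ℝ) : EReal)
    else ⊤).toReal, ?_, fun ν hν => (toReal_iInf_rat (hU ν hν)).symm⟩
  refine measurable_ereal_toReal.comp (Measurable.iInf fun q => ?_)
  exact Measurable.ite (measurable_countingPath q measurableSet_Ici) measurable_const
    measurable_const

/-- By adjunction, `F(X) < y` is the comparison of `X` with the inverse of `F` at the fixed point
`y`, so evaluation at a random point is avoided. -/
theorem DegOnePair.measurable_plus_comp {Ω : Type*} [MeasurableSpace Ω] {F : Ω → DegOnePair}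
    {X : Ω → ℝ} (hF : Measurable F) (hX : Measurable X) :
    Measurable fun ω => (F ω).plus (X ω) := by
  refine measurable_of_Iio fun y => ?_
  have : (fun ω => (F ω).plus (X ω)) ⁻¹' Iio y = {ω | X ω < (F ω).inv.minus y} := by
    ext ω
    exact (F ω).plus_lt_iff _ _
  rw [this]
  exact measurableSet_lt hX ((DegOnePair.measurable_minus y).comp
    (DegOnePair.measurable_inv.comp hF))

/-- The value at `x` of the right-continuous member of the flow map of the interval `I`, as a
function of the point measure and of the disturbances. -/
noncomputable def drivenValue (I : BddInterval) (x : ℝ) (p : Measure ℝ × (ℤ → DegOnePair)) : ℝ :=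
  compFrom (fun k => (p.2 k).plus) (countingPath p.1 (sInf I.1))
    (countingPath p.1 (sSup I.1) - countingPath p.1 (sInf I.1)).toNat x

theorem measurable_drivenValue (I : BddInterval) (x : ℝ) : Measurable (drivenValue I x) := by
  have h1 : ∀ (m : ℤ) (k : ℕ), Measurable fun p : Measure ℝ × (ℤ → DegOnePair) =>
      compFrom (fun k => (p.2 k).plus) m k x := by
    intro m k
    induction k with
    | zero => exact measurable_const
    | succ k ih =>
      exact DegOnePair.measurable_plus_comp ((measurable_pi_apply _).comp measurable_snd) ih
  -- The first index and the number of maps are random but range over a countable set, so they may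
  -- be frozen.
  have h2 : Measurable fun q : (ℤ × ℤ) × (Measure ℝ × (ℤ → DegOnePair)) =>
      compFrom (fun k => (q.2.2 k).plus) q.1.1 (q.1.2 - q.1.1).toNat x :=
    measurable_from_prod_countable_right fun a => h1 a.1 (a.2 - a.1).toNat
  have hc : ∀ t, Measurable fun p : Measure ℝ × (ℤ → DegOnePair) => countingPath p.1 t :=
    fun t => (measurable_countingPath t).comp measurable_fst
  exact h2.comp (((hc (sInf I.1)).prodMk (hc (sSup I.1))).prodMk measurable_id)

/-- With no mass at the endpoints, left limits of the counting path equal its values there, so the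
four types of interval obey one formula. -/
theorem IsDrivenFlow.plus_eq_drivenValue {ν : Measure ℝ} {F : ℤ → DegOnePair} {φ : CadlagWeakFlow}
    (hφ : IsDrivenFlow (countingPath ν) F φ) (hν : IsIntegerValued ν) {I : BddInterval}
    (hinf : ν {sInf I.1} = 0) (hsup : ν {sSup I.1} = 0) (x : ℝ) :
    (φ.toFun I).plus x = drivenValue I x (ν, F) := by
  have h1 := hν.leftLim_countingPath_of_null hinf
  have h2 := hν.leftLim_countingPath_of_null hsup
  unfold drivenValue
  rcases I.cases_eq with hI | ⟨s, t, hs, ht, hst, hI⟩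
  · rw [φ.map_empty I hI, hI]
    simp [DegOnePair.ident, compFrom]
  · rw [← hs] at h1 ⊢
    rw [← ht] at h2 ⊢
    have h := hφ s t hst
    rw [h1, h2] at h
    rcases hI with hI | hI | hI | ⟨hlt, hI⟩
    · rw [hI, h.2.1.2]
    · rw [hI, h.2.2.2.2]
    · rw [hI, h.1.2]
    · rw [hI, (h.2.2.1 hlt).2]

/-! ### Uniqueness of the law of a disturbance flow. -/

/-- Given the point measure `N`, the maps `F n` are independent with laws `κ (t_n)`. -/
def HasDisturbanceLaw {Ω : Type*} [MeasurableSpace Ω] (κ : Kernel ℝ DegOnePair) (P : Measure Ω)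
    (N : Ω → Measure ℝ) (F : ℤ → Ω → DegOnePair) : Prop :=
  ∀ A : Set (Measure ℝ), MeasurableSet A → ∀ S : Finset ℤ, ∀ B : ℤ → Set DegOnePair,
    (∀ n, MeasurableSet (B n)) →
    P {ω | N ω ∈ A ∧ ∀ n ∈ S, F n ω ∈ B n} =
      ∫⁻ ω in {ω | N ω ∈ A}, ∏ n ∈ S, κ (arrivalTime (N ω) n) (B n) ∂P

/-- Measurable versions of the arrival times allow the integral to be moved to the law of `N`, so
that the right-hand side no longer refers to the probability space. -/
theorem HasDisturbanceLaw.measure_eq_setLIntegral_map {Ω : Type*} [MeasurableSpace Ω] {r : ℝ≥0}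
    {P : Measure Ω} {N : Ω → Measure ℝ} {κ : Kernel ℝ DegOnePair} {F : ℤ → Ω → DegOnePair}
    (h : HasDisturbanceLaw κ P N F) (hN : IsPoissonRandomMeasure r P N) {g : ℤ → Measure ℝ → ℝ}
    (hg : ∀ n, Measurable (g n)) (hgeq : ∀ n ν, IsIntegerValued ν → arrivalTime ν n = g n ν)
    {A : Set (Measure ℝ)} (hA : MeasurableSet A) (S : Finset ℤ) {B : ℤ → Set DegOnePair}
    (hB : ∀ n, MeasurableSet (B n)) :
    P {ω | N ω ∈ A ∧ ∀ n ∈ S, F n ω ∈ B n} =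
      ∫⁻ ν in A, ∏ n ∈ S, κ (g n ν) (B n) ∂(P.map N) := by
  have hm : Measurable fun ν => ∏ n ∈ S, κ (g n ν) (B n) :=
    Finset.measurable_prod _ fun n _ => (κ.measurable_coe (hB n)).comp (hg n)
  rw [h A hA S B hB, setLIntegral_map hA hm hN.measurable]
  refine lintegral_congr_ae (ae_restrict_of_ae ?_)
  filter_upwards [hN.ae_isIntegerValued] with ω hω
  exact Finset.prod_congr rfl fun n _ => by rw [hgeq n _ hω]

section Uniqueness

variable {Ω Ω' : Type*} [MeasurableSpace Ω] [MeasurableSpace Ω'] {P : Measure Ω}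
  {P' : Measure Ω'} [IsProbabilityMeasure P] [IsProbabilityMeasure P']

/-- The joint law of the point measure and of the disturbances is determined by the intensity and
by the disturbance kernel. -/
theorem map_prodMk_eq {r : ℝ≥0} {N : Ω → Measure ℝ} {N' : Ω' → Measure ℝ} {κ : Kernel ℝ DegOnePair}
    {F : ℤ → Ω → DegOnePair} {F' : ℤ → Ω' → DegOnePair}
    (hN : IsPoissonRandomMeasure r P N) (hN' : IsPoissonRandomMeasure r P' N')
    (hF : ∀ n, Measurable (F n)) (hF' : ∀ n, Measurable (F' n))
    (h : HasDisturbanceLaw κ P N F) (h' : HasDisturbanceLaw κ P' N' F') :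
    P.map (fun ω => (N ω, fun n => F n ω)) = P'.map (fun ω => (N' ω, fun n => F' n ω)) := by
  choose g hg hgeq using exists_measurable_eq_arrivalTime
  have hF₀ : Measurable fun ω n => F n ω := measurable_pi_lambda _ hF
  have hF₀' : Measurable fun ω n => F' n ω := measurable_pi_lambda _ hF'
  have hX := hN.measurable.prodMk hF₀
  have hX' := hN'.measurable.prodMk hF₀'
  have hprob := Measure.isProbabilityMeasure_map (μ := P) hX.aemeasurable
  refine Measure.ext_prod fun {A T} hA hT => ?_
  have hcyl : ∀ (S : Finset ℤ) (B : ℤ → Set DegOnePair), (∀ n, MeasurableSet (B n)) →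
      (P.restrict (N ⁻¹' A)).map (fun ω n => F n ω) ((S : Set ℤ).pi B) =
        (P'.restrict (N' ⁻¹' A)).map (fun ω n => F' n ω) ((S : Set ℤ).pi B) := by
    intro S B hB
    have hm : MeasurableSet ((S : Set ℤ).pi B) :=
      MeasurableSet.pi S.countable_toSet fun n _ => hB n
    have e1 := h.measure_eq_setLIntegral_map hN hg hgeq hA S hB
    have e2 := h'.measure_eq_setLIntegral_map hN' hg hgeq hA S hB
    rw [hN.map_eq_map hN', ← e2] at e1
    rw [Measure.map_apply hF₀ hm, Measure.map_apply hF₀' hm, Measure.restrict_apply (hF₀ hm),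
      Measure.restrict_apply (hF₀' hm), inter_comm, inter_comm _ (N' ⁻¹' A)]
    exact e1
  have hmeas : (P.restrict (N ⁻¹' A)).map (fun ω n => F n ω) =
      (P'.restrict (N' ⁻¹' A)).map (fun ω n => F' n ω) := by
    -- With the event `A` for `N` fixed, cylinders form a π-system generating the σ-algebra on
    -- sequences; the empty cylinder condition compares total masses.
    refine ext_of_generate_finite _ generateFrom_squareCylinders.symm
      (isPiSystem_squareCylinders (fun n => MeasurableSpace.isPiSystem_measurableSet)
        fun n => MeasurableSet.univ (α := DegOnePair)) ?_ ?_
    · rintro _ ⟨S, B, hB, rfl⟩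
      exact hcyl S B fun n => hB n (mem_univ n)
    · simpa using hcyl ∅ (fun _ => univ) fun _ => MeasurableSet.univ
  have hT' := DFunLike.congr_fun hmeas T
  rw [Measure.map_apply hF₀ hT, Measure.map_apply hF₀' hT, Measure.restrict_apply (hF₀ hT),
    Measure.restrict_apply (hF₀' hT), inter_comm, inter_comm _ (N' ⁻¹' A)] at hT'
  rw [Measure.map_apply hX (hA.prod hT), Measure.map_apply hX' (hA.prod hT)]
  exact hT'

/-- Two Poisson disturbance flows with the same disturbances have the same law. -/
theorem IsPoissonDisturbanceFlow.map_eq_map {η : ℝ → Kernel ℝ DegOnePair} {h : ℝ}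
    {Φ : Ω → CadlagWeakFlow} {Φ' : Ω' → CadlagWeakFlow} (hΦ : IsPoissonDisturbanceFlow η h P Φ)
    (hΦ' : IsPoissonDisturbanceFlow η h P' Φ') : P.map Φ = P'.map Φ' := by
  obtain ⟨hm, N, F, hN, hF, hlaw, hdr⟩ := hΦ
  obtain ⟨hm', N', F', hN', hF', hlaw', hdr'⟩ := hΦ'
  have hpair := map_prodMk_eq hN hN' hF hF' hlaw hlaw'
  have hX := hN.measurable.prodMk (measurable_pi_lambda (fun ω n => F n ω) hF)
  have hX' := hN'.measurable.prodMk (measurable_pi_lambda (fun ω n => F' n ω) hF')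
  let e : CadlagWeakFlow → BddInterval × ℝ → ℝ := fun φ i => (φ.toFun i.1).plus i.2
  have he : Measurable e := measurable_pi_lambda _ fun i =>
    (DegOnePair.measurable_plus i.2).comp (CadlagWeakFlow.measurable_toFun i.1)
  refine map_eq_map_of_finiteDimensional he ?_ hm hm' fun J => ?_
  · refine iSup_le fun I => ?_
    rw [← measurable_iff_comap_le]
    exact @DegOnePair.measurable_of_plus _ (MeasurableSpace.comap e inferInstance) _ fun x =>
      (measurable_pi_apply (I, x)).comp (comap_measurable e)
  · let H : Measure ℝ × (ℤ → DegOnePair) → J → ℝ := fun p i => drivenValue i.1.1 i.1.2 p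
    have hH : Measurable H := measurable_pi_lambda _ fun i => measurable_drivenValue _ _
    have e1 : (fun ω (i : J) => e (Φ ω) i) =ᵐ[P] H ∘ fun ω => (N ω, fun n => F n ω) := by
      -- Only finitely many intervals occur in `J`, so the exceptional events attached to their
      -- endpoints have a null union.
      have hall : ∀ᵐ ω ∂P, ∀ i : J, N ω {sInf i.1.1.1} = 0 ∧ N ω {sSup i.1.1.1} = 0 :=
        ae_all_iff.2 fun i => (hN.ae_singleton_eq_zero _).and (hN.ae_singleton_eq_zero _)
      filter_upwards [hall, hN.ae_isIntegerValued, hdr] with ω h1 h2 h3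
      exact funext fun i => h3.plus_eq_drivenValue h2 (h1 i).1 (h1 i).2 _
    have e2 : (fun ω (i : J) => e (Φ' ω) i) =ᵐ[P'] H ∘ fun ω => (N' ω, fun n => F' n ω) := by
      have hall : ∀ᵐ ω ∂P', ∀ i : J, N' ω {sInf i.1.1.1} = 0 ∧ N' ω {sSup i.1.1.1} = 0 :=
        ae_all_iff.2 fun i => (hN'.ae_singleton_eq_zero _).and (hN'.ae_singleton_eq_zero _)
      filter_upwards [hall, hN'.ae_isIntegerValued, hdr'] with ω h1 h2 h3
      exact funext fun i => h3.plus_eq_drivenValue h2 (h1 i).1 (h1 i).2 _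
    rw [Measure.map_congr e1, Measure.map_congr e2, ← Measure.map_map hH hX,
      ← Measure.map_map hH hX', hpair]

end Uniqueness

/-! ### Time-reversal of disturbance flows. -/

/-- Given `N`, the map `F (1 - n)` has law `η h` at `t_{1-n}`, and `t_{1-n}` is minus the `n`-th
arrival time of the reflected measure. The sign change built into `reversedInverse` absorbs this
minus. -/
theorem HasDisturbanceLaw.reversal {Ω : Type*} [MeasurableSpace Ω] {r : ℝ≥0} {P : Measure Ω}
    {N : Ω → Measure ℝ} {η : ℝ → Kernel ℝ DegOnePair} {h : ℝ} {F : ℤ → Ω → DegOnePair}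
    (hlaw : HasDisturbanceLaw (η h) P N F) (hN : IsPoissonRandomMeasure r P N) :
    HasDisturbanceLaw (reversedInverse η h) P (fun ω => (N ω).map (fun x => -x))
      (fun n ω => (F (1 - n) ω).inv) := by
  intro A hA S B hB
  have hA' := Measure.measurable_map _ measurable_neg hA
  let σ : ℤ ↪ ℤ := ⟨fun n => 1 - n, sub_right_injective⟩
  have hσ := hlaw _ hA' (S.map σ) (fun n => DegOnePair.inv ⁻¹' B (1 - n))
    fun n => DegOnePair.measurable_inv (hB _)
  simp only [Finset.forall_mem_map, Finset.prod_map, σ, Function.Embedding.coeFn_mk,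
    mem_preimage, sub_sub_cancel] at hσ
  rw [hσ]
  refine lintegral_congr_ae (ae_restrict_of_ae ?_)
  filter_upwards [hN.ae_isIntegerValued, hN.map_neg.ae_isIntegerValued, hN.ae_singleton_eq_zero 0]
    with ω h1 h2 h3
  refine Finset.prod_congr rfl fun n _ => ?_
  rw [h1.arrivalTime_map_neg h2 h3, reversedInverse,
    Kernel.map_apply' _ DegOnePair.measurable_inv _ (hB n), Kernel.comap_apply, neg_neg]

theorem IsPoissonDisturbanceFlow.reversal {Ω : Type*} [MeasurableSpace Ω] {P : Measure Ω}
    {η : ℝ → Kernel ℝ DegOnePair} {h : ℝ} {Φ : Ω → CadlagWeakFlow}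
    (hΦ : IsPoissonDisturbanceFlow η h P Φ) :
    IsPoissonDisturbanceFlow (reversedInverse η) h P (fun ω => (Φ ω).reversal) := by
  obtain ⟨hm, N, F, hN, hF, hlaw, hdr⟩ := hΦ
  refine ⟨CadlagWeakFlow.measurable_reversal.comp_aemeasurable hm,
    fun ω => (N ω).map (fun x => -x), fun n ω => (F (1 - n) ω).inv, hN.map_neg,
    fun n => DegOnePair.measurable_inv.comp (hF _), HasDisturbanceLaw.reversal hlaw hN, ?_⟩
  filter_upwards [hN.ae_isIntegerValued, hN.map_neg.ae_isIntegerValued, hN.ae_singleton_eq_zero 0,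
    hdr] with ω h1 h2 h3 h4
  refine h4.reversal (h1.countingPath_map_neg h2 h3) fun t => ?_
  -- Reflection is an involution, so the formula for the left limits of the new path is the counting
  -- path formula applied to the reflected measure.
  have hinv : ((N ω).map (fun x => -x)).map (fun x => -x) = N ω := by
    rw [Measure.map_map measurable_neg measurable_neg]
    simp
  have h0 : (N ω).map (fun x => -x) {0} = 0 := by
    rw [Measure.map_apply measurable_neg (measurableSet_singleton 0)]
    simpa using h3
  have h5 := h2.countingPath_map_neg (by rwa [hinv]) h0 (-t)
  rw [hinv, neg_neg] at h5
  rw [h5, neg_neg]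

theorem mainTheorem8 (η : ℝ → Kernel ℝ DegOnePair) (hη : InDStar η) (h : ℝ) (hh : 0 < h) :
    (∀ {Ω : Type*} [MeasurableSpace Ω] (P : Measure Ω) [IsProbabilityMeasure P]
      (Φ : Ω → CadlagWeakFlow), IsPoissonDisturbanceFlow η h P Φ →
        IsPoissonDisturbanceFlow (reversedInverse η) h P (fun ω => (Φ ω).reversal)) ∧
    (∀ μ : Measure CadlagWeakFlow, IsDisturbanceFlowLaw η h μ →
      ∀ ν : Measure CadlagWeakFlow,
        IsDisturbanceFlowLaw (reversedInverse η) h ν ↔ ν = μ.map CadlagWeakFlow.reversal) := by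
  have hrev : ∀ {Ω : Type} [MeasurableSpace Ω] (P : Measure Ω) (Φ : Ω → CadlagWeakFlow),
      IsPoissonDisturbanceFlow η h P Φ →
        P.map (fun ω => (Φ ω).reversal) = (P.map Φ).map CadlagWeakFlow.reversal :=
    fun P Φ hΦ => (AEMeasurable.map_map_of_aemeasurable
      CadlagWeakFlow.measurable_reversal.aemeasurable hΦ.1).symm
  refine ⟨fun P _ Φ hΦ => hΦ.reversal, ?_⟩
  rintro μ ⟨Ω, _, P, Φ, hP, hΦ, rfl⟩ ν
  constructor
  · rintro ⟨Ω', _, P', Φ', hP', hΦ', rfl⟩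
    rw [← hrev P Φ hΦ]
    -- The reversal of `Φ` is itself a flow with the reversed disturbances, so any other such flow,
    -- possibly on another space, shares its law.
    exact hΦ'.map_eq_map hΦ.reversal
  · rintro rfl
    exact ⟨Ω, _, P, _, hP, hΦ.reversal, (hrev P Φ hΦ).symm⟩
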